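/- Let $n\ge 2$ and let $\sigma$ denote the $(n-1)$-dimensional Hausdorff measure on $\mathbb{R}^n$, normalized so as to coincide with Euclidean surface area; let $\omega_n$ be the volume of the unit ball of $\mathbb{R}^n$. For an open set $\Omega\subseteq\mathbb{R}^n$ such that every compact subset of $\partial\Omega$ has finite $\sigma$-measure and a point $p\in\Omega$, the touching set is $$T(\partial\Omega,p):=\{z\in\partial\Omega : |p-z|=\operatorname{dist}(p,\partial\Omega)\},$$ and for $z\in T(\partial\Omega,p)$, with $r:=|z-p|$, the spherical flatness index is $$S_z(\partial\Omega,p):=\frac{2}{n\omega_n r}\liminf_{\rho\searrow0}\left(\liminf_{\substack{\alpha\to z\\ \alpha\notin\overline\Omega}}\int_{\partial\Omega\cap B(z,\rho)}\frac{\langle\alpha-x,\alpha-p\rangle}{|x-\alpha|^n}\,d\sigma(x)\right).$$ **Proposition 2.2.** Let $x_0\in\mathbb{R}^n$, $R>0$, $\Omega=B(x_0,R)$ (the open Euclidean ball) and $x_1\in\Omega$. 1. If $x_1\neq x_0$, then $T(\partial\Omega,x_1)$ is a singleton $\{z\}=\partial\Omega\cap\partial B(x_1,\operatorname{dist}(x_1,\partial\Omega))$,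 and $S_z(\partial\Omega,x_1)=1$. 2. If $x_1=x_0$, then $T(\partial\Omega,x_1)=\partial\Omega$, and $S_z(\partial\Omega,x_1)=1$ for every $z\in\partial\Omega$. -/

import Mathlib

open MeasureTheory Filter Topology

noncomputable section

/-- The touching set `T(∂Ω, x₀)`: the points of `∂Ω` at minimal distance from `x₀`. -/
def touchingSet {n : ℕ} (Ω : Set (EuclideanSpace ℝ (Fin n))) (x₀ : EuclideanSpace ℝ (Fin n)) :
    Set (EuclideanSpace ℝ (Fin n)) :=
  {z | z ∈ frontier Ω ∧ dist x₀ z = Metric.infDist x₀ (frontier Ω)}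

/-- The volume `ω_n` of the unit ball of `ℝⁿ`. -/
def unitBallVolume (n : ℕ) : ℝ :=
  (volume : Measure (EuclideanSpace ℝ (Fin n))).real (Metric.ball 0 1)

/-- The integral `∫_{∂Ω ∩ B(z,ρ)} ⟨α - x, α - x₀⟩ / |x - α|ⁿ dσ(x)`, where `σ` is the
`(n-1)`-dimensional Hausdorff measure, normalized so that it is the Euclidean surface area
(`μHE[d]` agrees with Lebesgue measure on `d`-dimensional Euclidean spaces). -/
def flatnessIntegral {n : ℕ} (Ω : Set (EuclideanSpace ℝ (Fin n)))
    (x₀ z : EuclideanSpace ℝ (Fin n)) (ρ : ℝ) (α : EuclideanSpace ℝ (Fin n)) : ℝ :=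
  ∫ x in frontier Ω ∩ Metric.ball z ρ, inner ℝ (α - x) (α - x₀) / ‖x - α‖ ^ n ∂μHE[n - 1]

/-- The spherical flatness index `S_z(∂Ω, x₀)`, for `z` in the touching set, where `r = |z - x₀|`.
The lower limits are taken in the extended real line, so that they always have their usual
meaning. -/
def sphericalIndex {n : ℕ} (Ω : Set (EuclideanSpace ℝ (Fin n)))
    (x₀ z : EuclideanSpace ℝ (Fin n)) : EReal :=
  ((2 / (n * unitBallVolume n * ‖z - x₀‖) : ℝ) : EReal) *
    liminf (fun ρ : ℝ => liminf (fun α => (flatnessIntegral Ω x₀ z ρ α : EReal))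
      (𝓝[(closure Ω)ᶜ] z)) (𝓝[>] (0 : ℝ))

end

/-!
Write `n = m + 1`, let `S` be the sphere of centre `x₀` and radius `R`, and let an outer point be
`α = x₀ + t • e` with `‖e‖ = 1`, `t > R`. Put `p = x₀ + R • e` and `d = t - R`. For `x ∈ S` one has
`‖x - α‖² = d² + (t / R) ‖x - p‖²` and `⟪α - x, e⟫ = d + ‖x - p‖² / (2R)`, so near `p` the axial
kernel `⟪α - x, e⟫ / ‖x - α‖ⁿ` is the flat kernel `d / (d² + ‖y‖²)^(n/2)` of the tangent hyperplane
up to a factor close to `1` and an error of size `‖y‖^(2-n) / (2R)`, whose integral over a disc of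
radius `δ` is of order `δ`. The flat kernel integrates to the solid angle of a hyperplane, half the
area of the unit sphere, that is `n ω_n / 2`, and as `d → 0` its mass concentrates at the origin.

The passage between the surface measure and Lebesgue measure uses no area formula: the graph chart
`sphereChart` of `S` around `p` does not decrease distances and has a Lipschitz constant
`chartConst R δ` on the disc of radius `δ`, which tends to `1` as `δ → 0`. This distorts the
Hausdorff measure by a factor between `1` and `chartConst R δ ^ m`.

The vector `α - x₁` in the flatness integral is `(t - a) • e - w` with `w` orthogonal to `e`, and
`w → 0` as `α → z`, since `x₁` lies on the radius of `z`. The integral of the absolute value of the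
kernel belonging to `w` grows like `‖w‖ log (1 / d)`, which need not be small, but by reflection in the axis its integral over a cap
centred at `p` vanishes (`setIntegral_transversalKernel_eq_zero`). Off such a cap it is bounded, so
its contribution tends to `0`. Since `t - a → ‖z - x₁‖`, the inner lower limit is squeezed between
two functions of `ρ` that both tend to `‖z - x₁‖ n ω_n / 2` (`liminf_flatnessIntegral_bounds`).
-/

/-! ### Hausdorff measure under bi-Lipschitz maps -/

theorem LipschitzOnWith.euclideanHausdorffMeasure_image_le {X Y : Type*} [EMetricSpace X]
    [MeasurableSpace X] [BorelSpace X] [EMetricSpace Y] [MeasurableSpace Y] [BorelSpace Y]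
    {f : X → Y} {K : NNReal} {s : Set X} (h : LipschitzOnWith K f s) (d : ℕ) :
    μHE[d] (f '' s) ≤ (K : ENNReal) ^ d * μHE[d] s := by
  simp only [Measure.euclideanHausdorffMeasure_def, Measure.smul_apply, ENNReal.smul_def,
    smul_eq_mul]
  have := h.hausdorffMeasure_image_le (d := d) (by positivity)
  rw [ENNReal.rpow_natCast] at this
  rw [mul_left_comm]
  gcongr

theorem AntilipschitzWith.le_euclideanHausdorffMeasure_image {X Y : Type*} [EMetricSpace X]
    [MeasurableSpace X] [BorelSpace X] [EMetricSpace Y] [MeasurableSpace Y] [BorelSpace Y]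
    {f : X → Y} {K : NNReal} (h : AntilipschitzWith K f) (d : ℕ) (s : Set X) :
    μHE[d] s ≤ (K : ENNReal) ^ d * μHE[d] (f '' s) := by
  simp only [Measure.euclideanHausdorffMeasure_def, Measure.smul_apply, ENNReal.smul_def,
    smul_eq_mul]
  have := h.le_hausdorffMeasure_image (d := d) (by positivity) s
  rw [ENNReal.rpow_natCast] at this
  rw [mul_left_comm]
  gcongr

/-- An expanding parametrization pushes Lebesgue measure forward to a measure that is at most the
surface measure of its image. -/
theorem map_restrict_volume_le_of_antilipschitz {Y : Type*} [EMetricSpace Y] [MeasurableSpace Y]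
    [BorelSpace Y] {m : ℕ} {ψ : EuclideanSpace ℝ (Fin m) → Y} (hψ : Measurable ψ)
    (h : AntilipschitzWith 1 ψ) (s : Set (EuclideanSpace ℝ (Fin m))) :
    (volume.restrict s).map ψ ≤ μHE[m].restrict (ψ '' s) := by
  refine Measure.le_iff.2 fun A hA => ?_
  rw [Measure.map_apply hψ hA, Measure.restrict_apply (hψ hA), Measure.restrict_apply hA,
    ← EuclideanSpace.euclideanHausdorffMeasure_eq_volume]
  refine (h.le_euclideanHausdorffMeasure_image m _).trans ?_
  simp only [ENNReal.coe_one, one_pow, one_mul]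
  rw [← Set.image_preimage_inter]

/-- The surface measure of a Lipschitz parametrized piece is controlled by the push-forward of
Lebesgue measure. -/
theorem restrict_image_le_map_of_lipschitzOn {Y : Type*} [EMetricSpace Y] [MeasurableSpace Y]
    [BorelSpace Y] {m : ℕ} {ψ : EuclideanSpace ℝ (Fin m) → Y} (hψ : Measurable ψ) {K : NNReal}
    {s : Set (EuclideanSpace ℝ (Fin m))} (h : LipschitzOnWith K ψ s) :
    μHE[m].restrict (ψ '' s) ≤ (K : ENNReal) ^ m • (volume.restrict s).map ψ := by
  refine Measure.le_iff.2 fun A hA => ?_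
  rw [Measure.smul_apply, Measure.map_apply hψ hA, Measure.restrict_apply (hψ hA),
    Measure.restrict_apply hA, ← EuclideanSpace.euclideanHausdorffMeasure_eq_volume, smul_eq_mul,
    ← Set.image_preimage_inter]
  exact (h.mono Set.inter_subset_right).euclideanHausdorffMeasure_image_le m

/-! ### The graph chart of a sphere -/

section Chart

variable {F V : Type*} [NormedAddCommGroup F] [InnerProductSpace ℝ F] [NormedAddCommGroup V]
  [InnerProductSpace ℝ V]

/-- The chart of the sphere of centre `x₀` and radius `R` that writes the hemisphere around
`x₀ + R • e` as a graph over the hyperplane `j '' univ`, which is meant to be orthogonal to the unit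
vector `e`. Off the ball of radius `R` the square root is `0` and the value is not on the sphere. -/
noncomputable def sphereChart (x₀ : V) (R : ℝ) (e : V) (j : F →ₗᵢ[ℝ] V) (y : F) : V :=
  x₀ + (j y + √(R ^ 2 - ‖y‖ ^ 2) • e)

variable {x₀ e : V} {R : ℝ} {j : F →ₗᵢ[ℝ] V}

theorem norm_add_smul_sq (he : ‖e‖ = 1) (hj : ∀ y, inner ℝ (j y) e = 0) (y : F) (c : ℝ) :
    ‖j y + c • e‖ ^ 2 = ‖y‖ ^ 2 + c ^ 2 := by
  rw [norm_add_sq_real, inner_smul_right, hj, norm_smul, he, j.norm_map, Real.norm_eq_abs]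
  simp

theorem continuous_sphereChart : Continuous (sphereChart x₀ R e j) := by
  unfold sphereChart
  have := j.continuous
  fun_prop

theorem sphereChart_zero (hR : 0 ≤ R) : sphereChart x₀ R e j 0 = x₀ + R • e := by
  simp [sphereChart, Real.sqrt_sq hR]

theorem dist_sphereChart_sq (he : ‖e‖ = 1) (hj : ∀ y, inner ℝ (j y) e = 0) (y y' : F) :
    dist (sphereChart x₀ R e j y) (sphereChart x₀ R e j y') ^ 2 =
      dist y y' ^ 2 + (√(R ^ 2 - ‖y‖ ^ 2) - √(R ^ 2 - ‖y'‖ ^ 2)) ^ 2 := by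
  rw [dist_eq_norm, dist_eq_norm, ← norm_add_smul_sq he hj, map_sub]
  congr 2
  simp only [sphereChart, sub_smul]
  abel

theorem antilipschitzWith_sphereChart (he : ‖e‖ = 1) (hj : ∀ y, inner ℝ (j y) e = 0) :
    AntilipschitzWith 1 (sphereChart x₀ R e j) := by
  refine AntilipschitzWith.of_le_mul_dist fun y y' => ?_
  rw [NNReal.coe_one, one_mul]
  refine le_of_sq_le_sq ?_ dist_nonneg
  rw [dist_sphereChart_sq he hj]
  nlinarith [sq_nonneg (√(R ^ 2 - ‖y‖ ^ 2) - √(R ^ 2 - ‖y'‖ ^ 2))]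

/-- A Lipschitz constant of `sphereChart` on the ball of radius `δ`. It tends to `1` with `δ → 0`,
which makes the chart almost isometric near its centre. -/
noncomputable def chartConst (R δ : ℝ) : NNReal := Real.toNNReal (R / √(R ^ 2 - δ ^ 2))

theorem coe_chartConst (hR : 0 < R) (δ : ℝ) :
    (chartConst R δ : ℝ) = R / √(R ^ 2 - δ ^ 2) :=
  Real.coe_toNNReal _ (by positivity)

theorem tendsto_chartConst (hR : 0 < R) :
    Tendsto (fun δ => (chartConst R δ : ℝ)) (𝓝 0) (𝓝 1) := by
  simp only [coe_chartConst hR]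
  have : ContinuousAt (fun δ : ℝ => R / √(R ^ 2 - δ ^ 2)) 0 := by
    refine ContinuousAt.div (by fun_prop) (by fun_prop) ?_
    simp [Real.sqrt_sq hR.le, hR.ne']
  simpa [ContinuousAt, Real.sqrt_sq hR.le, hR.ne'] using this

theorem lipschitzOnWith_sphereChart (he : ‖e‖ = 1) (hj : ∀ y, inner ℝ (j y) e = 0) (hR : 0 < R)
    {δ : ℝ} (hδ : 0 < δ) (hδR : δ < R) :
    LipschitzOnWith (chartConst R δ) (sphereChart x₀ R e j) (Metric.ball 0 δ) := by
  refine LipschitzOnWith.of_dist_le_mul fun y hy y' hy' => ?_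
  rw [mem_ball_zero_iff] at hy hy'
  rw [coe_chartConst hR]
  refine le_of_sq_le_sq ?_ (by positivity)
  have hc : 0 < R ^ 2 - δ ^ 2 := by nlinarith
  rw [dist_sphereChart_sq he hj, mul_pow, div_pow, Real.sq_sqrt hc.le]
  set a := √(R ^ 2 - ‖y‖ ^ 2)
  set b := √(R ^ 2 - ‖y'‖ ^ 2)
  have hyn := norm_nonneg y
  have hyn' := norm_nonneg y'
  have ha : a ^ 2 = R ^ 2 - ‖y‖ ^ 2 := Real.sq_sqrt (by nlinarith)
  have hb : b ^ 2 = R ^ 2 - ‖y'‖ ^ 2 := Real.sq_sqrt (by nlinarith)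
  have ha0 : 0 ≤ a := Real.sqrt_nonneg _
  have hb0 : 0 ≤ b := Real.sqrt_nonneg _
  have hD : |‖y‖ - ‖y'‖| ≤ dist y y' := by rw [dist_eq_norm]; exact abs_norm_sub_norm_le _ _
  have hD2 : (‖y‖ - ‖y'‖) ^ 2 ≤ dist y y' ^ 2 := by
    rw [← sq_abs]; exact pow_le_pow_left₀ (abs_nonneg _) hD 2
  -- the difference of the heights is `(‖y'‖² - ‖y‖²) / (a + b)`
  have key : (a - b) ^ 2 * (a + b) ^ 2 = (‖y‖ - ‖y'‖) ^ 2 * (‖y‖ + ‖y'‖) ^ 2 := by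
    have : (a - b) * (a + b) = (‖y'‖ - ‖y‖) * (‖y‖ + ‖y'‖) := by nlinarith
    rw [← mul_pow, ← mul_pow, this]; ring
  have h1 : 4 * (R ^ 2 - δ ^ 2) ≤ (a + b) ^ 2 := by
    have h2 : R ^ 2 - δ ^ 2 ≤ a ^ 2 := by nlinarith
    have h3 : R ^ 2 - δ ^ 2 ≤ b ^ 2 := by nlinarith
    have h4 : R ^ 2 - δ ^ 2 ≤ a * b := by
      refine le_of_sq_le_sq ?_ (by positivity)
      rw [mul_pow, sq]
      exact mul_le_mul h2 h3 hc.le (sq_nonneg _)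
    nlinarith
  have h5 : (‖y‖ + ‖y'‖) ^ 2 ≤ 4 * δ ^ 2 := by nlinarith
  have h6 : (a - b) ^ 2 * (R ^ 2 - δ ^ 2) ≤ dist y y' ^ 2 * δ ^ 2 := by
    have := mul_le_mul hD2 h5 (sq_nonneg _) (sq_nonneg _)
    nlinarith [mul_le_mul_of_nonneg_left h1 (sq_nonneg (a - b))]
  rw [div_mul_eq_mul_div, le_div_iff₀ hc]
  nlinarith

theorem image_sphereChart_subset_sphere (he : ‖e‖ = 1) (hj : ∀ y, inner ℝ (j y) e = 0)
    (hR : 0 < R) {δ : ℝ} (hδR : δ ≤ R) :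
    sphereChart x₀ R e j '' Metric.ball 0 δ ⊆ Metric.sphere x₀ R := by
  rintro _ ⟨y, hy, rfl⟩
  rw [mem_ball_zero_iff] at hy
  have hyn := norm_nonneg y
  rw [mem_sphere_iff_norm, sphereChart, add_sub_cancel_left,
    ← sq_eq_sq₀ (norm_nonneg _) hR.le, norm_add_smul_sq he hj, Real.sq_sqrt (by nlinarith)]
  ring

theorem sphere_inter_ball_subset_image (he : ‖e‖ = 1) (hj : ∀ y, inner ℝ (j y) e = 0)
    (hjr : ∀ v, inner ℝ v e = 0 → v ∈ Set.range j) (hR : 0 < R) {δ : ℝ} (hδR : δ ≤ R) :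
    Metric.sphere x₀ R ∩ Metric.ball (x₀ + R • e) δ ⊆ sphereChart x₀ R e j '' Metric.ball 0 δ := by
  rintro x ⟨hx, hxp⟩
  set c := inner ℝ (x - x₀) e
  obtain ⟨y, hy⟩ := hjr (x - x₀ - c • e) (by
    rw [inner_sub_left, inner_smul_left, real_inner_self_eq_norm_sq, he]; simp [c])
  have hxy : x = x₀ + (j y + c • e) := by rw [hy]; abel
  rw [mem_sphere_iff_norm] at hx
  have h1 : ‖y‖ ^ 2 + c ^ 2 = R ^ 2 := by
    rw [← norm_add_smul_sq he hj, ← hx, hxy]; simp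
  have h2 : ‖y‖ ^ 2 + (c - R) ^ 2 < δ ^ 2 := by
    rw [← norm_add_smul_sq he hj]
    have : j y + (c - R) • e = x - (x₀ + R • e) := by rw [hxy, sub_smul]; abel
    rw [this]
    rw [mem_ball_iff_norm] at hxp
    gcongr
  have hδ : 0 < δ := Metric.pos_of_mem_ball hxp
  have hc : 0 ≤ c := by
    by_contra! hc
    nlinarith [sq_nonneg ‖y‖]
  refine ⟨y, ?_, ?_⟩
  · rw [mem_ball_zero_iff]
    refine lt_of_pow_lt_pow_left₀ 2 hδ.le ?_
    nlinarith [sq_nonneg (c - R)]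
  · rw [sphereChart, hxy]
    congr 3
    rw [← h1, add_sub_cancel_left, Real.sqrt_sq hc]

end Chart

/-- Every unit vector of `ℝᵐ⁺¹` has an orthogonal hyperplane that is an isometric copy of `ℝᵐ`. -/
theorem exists_linearIsometry_orthogonal {m : ℕ} {e : EuclideanSpace ℝ (Fin (m + 1))}
    (he : ‖e‖ = 1) :
    ∃ j : EuclideanSpace ℝ (Fin m) →ₗᵢ[ℝ] EuclideanSpace ℝ (Fin (m + 1)),
      (∀ y, inner ℝ (j y) e = 0) ∧ ∀ v, inner ℝ v e = 0 → v ∈ Set.range j := by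
  have hne : e ≠ 0 := by rintro rfl; simp at he
  have : Fact (Module.finrank ℝ (EuclideanSpace ℝ (Fin (m + 1))) = m + 1) := ⟨by simp⟩
  let b := OrthonormalBasis.fromOrthogonalSpanSingleton (𝕜 := ℝ) m hne
  refine ⟨(ℝ ∙ e)ᗮ.subtypeₗᵢ.comp b.repr.symm.toLinearIsometry, fun y => ?_, fun v hv => ?_⟩
  · rw [real_inner_comm]
    exact (Submodule.mem_orthogonal_singleton_iff_inner_right).1 (b.repr.symm y).2
  · refine ⟨b.repr ⟨v, ?_⟩, by simp⟩
    rw [Submodule.mem_orthogonal_singleton_iff_inner_right, real_inner_comm]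
    exact hv

/-! ### Integrals over the tangent hyperplane -/

open Real in
theorem lintegral_gaussian_norm_sq (m : ℕ) {s : ℝ} (hs : 0 < s) :
    ∫⁻ y : EuclideanSpace ℝ (Fin m), ENNReal.ofReal (rexp (-s * ‖y‖ ^ 2)) =
      ENNReal.ofReal ((π / s) ^ (m / 2 : ℝ)) := by
  have h := GaussianFourier.integral_rexp_neg_mul_sq_norm (V := EuclideanSpace ℝ (Fin m)) hs
  rw [finrank_euclideanSpace_fin] at h
  rw [← h, ofReal_integral_eq_lintegral_ofReal _ (ae_of_all _ fun _ => (exp_pos _).le)]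
  refine not_imp_comm.1 integral_undef ?_
  rw [h]
  positivity

open Real in
theorem lintegral_rpow_mul_exp_neg_mul {a r : ℝ} (ha : 0 < a) (hr : 0 < r) :
    ∫⁻ s in Set.Ioi (0 : ℝ), ENNReal.ofReal (s ^ (a - 1) * rexp (-(r * s))) =
      ENNReal.ofReal ((1 / r) ^ a * Gamma a) := by
  have h := integral_rpow_mul_exp_neg_mul_Ioi ha hr
  rw [← h, ofReal_integral_eq_lintegral_ofReal]
  · refine not_imp_comm.1 integral_undef ?_
    rw [h]
    have := Gamma_pos_of_pos ha
    positivity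
  · filter_upwards [ae_restrict_mem measurableSet_Ioi] with s hs
    have : (0 : ℝ) < s := hs
    positivity

/-- Half the surface area of the unit sphere of `ℝᵐ⁺¹`: the total solid angle under which a point
sees a hyperplane. -/
noncomputable def halfSphereArea (m : ℕ) : ℝ :=
  √Real.pi ^ (m + 1) / Real.Gamma ((m + 1 : ℝ) / 2)

theorem halfSphereArea_pos (m : ℕ) : 0 < halfSphereArea m := by
  have : 0 < Real.Gamma ((m + 1 : ℝ) / 2) := Real.Gamma_pos_of_pos (by positivity)
  unfold halfSphereArea
  positivity

theorem natCast_mul_unitBallVolume (m : ℕ) :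
    ((m + 1 : ℕ) : ℝ) * unitBallVolume (m + 1) = 2 * halfSphereArea m := by
  have hG : 0 < Real.Gamma ((m + 1 : ℝ) / 2) := Real.Gamma_pos_of_pos (by positivity)
  have h2 : Real.Gamma ((m + 1 : ℝ) / 2 + 1) = (m + 1 : ℝ) / 2 * Real.Gamma ((m + 1 : ℝ) / 2) :=
    Real.Gamma_add_one (by positivity)
  have : unitBallVolume (m + 1) = √Real.pi ^ (m + 1) / Real.Gamma ((m + 1 : ℝ) / 2 + 1) := by
    rw [unitBallVolume, Measure.real, EuclideanSpace.volume_ball]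
    simp only [ENNReal.ofReal_one, one_pow, one_mul, Fintype.card_fin, Nat.cast_add, Nat.cast_one]
    rw [ENNReal.toReal_ofReal]
    rw [h2]
    positivity
  rw [this, h2, halfSphereArea]
  push_cast
  field_simp

/-- The integral of `(1 + ‖y‖²)^(-(m+1)/2)`, through the Gamma integral
`c^(-a) Γ(a) = ∫ s^(a-1) e^(-cs) ds` with `c = 1 + ‖y‖²` and Tonelli's theorem. -/
theorem lintegral_one_div_sqrt_one_add_norm_sq (m : ℕ) :
    ∫⁻ y : EuclideanSpace ℝ (Fin m), ENNReal.ofReal (1 / √(1 + ‖y‖ ^ 2) ^ (m + 1)) =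
      ENNReal.ofReal (halfSphereArea m) := by
  set a : ℝ := (m + 1 : ℝ) / 2 with ha
  have ha0 : 0 < a := by positivity
  have hG : 0 < Real.Gamma a := Real.Gamma_pos_of_pos ha0
  have hpt (y : EuclideanSpace ℝ (Fin m)) :
      ENNReal.ofReal (1 / √(1 + ‖y‖ ^ 2) ^ (m + 1)) = ENNReal.ofReal (Real.Gamma a)⁻¹ *
        ∫⁻ s in Set.Ioi (0 : ℝ), ENNReal.ofReal (s ^ (a - 1) * Real.exp (-((1 + ‖y‖ ^ 2) * s))) := by
    have hc : 0 < 1 + ‖y‖ ^ 2 := by positivity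
    rw [lintegral_rpow_mul_exp_neg_mul ha0 hc, ← ENNReal.ofReal_mul (by positivity)]
    congr 1
    rw [mul_comm, mul_assoc, mul_inv_cancel₀ hG.ne', mul_one, Real.div_rpow zero_le_one hc.le,
      Real.one_rpow]
    congr 1
    rw [Real.sqrt_eq_rpow, ← Real.rpow_natCast, ← Real.rpow_mul hc.le, ha]
    congr 1
    push_cast; ring
  simp_rw [hpt]
  rw [lintegral_const_mul' _ _ ENNReal.ofReal_ne_top, lintegral_lintegral_swap]
  · have hin : ∀ s ∈ Set.Ioi (0 : ℝ), ∫⁻ y : EuclideanSpace ℝ (Fin m),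
        ENNReal.ofReal (s ^ (a - 1) * Real.exp (-((1 + ‖y‖ ^ 2) * s))) =
        ENNReal.ofReal (Real.pi ^ (m / 2 : ℝ)) *
          ENNReal.ofReal (s ^ ((1 / 2 : ℝ) - 1) * Real.exp (-(1 * s))) := by
      intro s hs
      have hs : (0 : ℝ) < s := hs
      have h1 (y : EuclideanSpace ℝ (Fin m)) :
          ENNReal.ofReal (s ^ (a - 1) * Real.exp (-((1 + ‖y‖ ^ 2) * s))) =
          ENNReal.ofReal (s ^ (a - 1) * Real.exp (-s)) *
            ENNReal.ofReal (Real.exp (-s * ‖y‖ ^ 2)) := by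
        rw [← ENNReal.ofReal_mul (by positivity), mul_assoc, ← Real.exp_add]
        congr 3; ring
      simp_rw [h1]
      rw [lintegral_const_mul' _ _ ENNReal.ofReal_ne_top, lintegral_gaussian_norm_sq m hs,
        ← ENNReal.ofReal_mul (by positivity), ← ENNReal.ofReal_mul (by positivity)]
      congr 1
      have h2 : s ^ (a - 1) = s ^ ((1 / 2 : ℝ) - 1) * s ^ (m / 2 : ℝ) := by
        rw [← Real.rpow_add hs]; congr 1; rw [ha]; ring
      rw [Real.div_rpow Real.pi_pos.le hs.le, h2, one_mul]
      have : 0 < s ^ (m / 2 : ℝ) := by positivity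
      field_simp
    rw [setLIntegral_congr_fun measurableSet_Ioi hin,
      lintegral_const_mul' _ _ ENNReal.ofReal_ne_top,
      lintegral_rpow_mul_exp_neg_mul (by norm_num) one_pos, ← ENNReal.ofReal_mul (by positivity),
      ← ENNReal.ofReal_mul (by positivity), halfSphereArea, ← ha]
    congr 1
    rw [Real.Gamma_one_half_eq, pow_succ, Real.sqrt_eq_rpow, ← Real.rpow_natCast,
      ← Real.rpow_mul Real.pi_pos.le]
    simp only [one_div, inv_one, Real.one_rpow, one_mul]
    rw [div_eq_inv_mul, inv_mul_eq_div, inv_mul_eq_div]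
  · refine Measurable.aemeasurable ?_
    fun_prop

theorem integrable_one_div_sqrt_one_add_norm_sq (m : ℕ) :
    Integrable fun y : EuclideanSpace ℝ (Fin m) => 1 / √(1 + ‖y‖ ^ 2) ^ (m + 1) := by
  refine ⟨Measurable.aestronglyMeasurable (by fun_prop), ?_⟩
  rw [hasFiniteIntegral_iff_ofReal (ae_of_all _ fun _ => by positivity),
    lintegral_one_div_sqrt_one_add_norm_sq]
  exact ENNReal.ofReal_lt_top

theorem integral_one_div_sqrt_one_add_norm_sq (m : ℕ) :
    ∫ y : EuclideanSpace ℝ (Fin m), 1 / √(1 + ‖y‖ ^ 2) ^ (m + 1) = halfSphereArea m := by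
  rw [integral_eq_lintegral_of_nonneg_ae (ae_of_all _ fun _ => by positivity)
    (integrable_one_div_sqrt_one_add_norm_sq m).aestronglyMeasurable,
    lintegral_one_div_sqrt_one_add_norm_sq, ENNReal.toReal_ofReal (halfSphereArea_pos m).le]

theorem div_sqrt_eq_rescaled {m : ℕ} {d : ℝ} (hd : 0 < d) (y : EuclideanSpace ℝ (Fin m)) :
    d / √(d ^ 2 + ‖y‖ ^ 2) ^ (m + 1) =
      (d ^ m)⁻¹ * (1 / √(1 + ‖d⁻¹ • y‖ ^ 2) ^ (m + 1)) := by
  have h : √(d ^ 2 + ‖y‖ ^ 2) = d * √(1 + ‖d⁻¹ • y‖ ^ 2) := by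
    rw [← Real.sqrt_sq hd.le, ← Real.sqrt_mul (sq_nonneg _), Real.sqrt_sq hd.le, norm_smul,
      Real.norm_of_nonneg (by positivity)]
    congr 1
    field_simp
  rw [h, mul_pow, pow_succ]
  have : 0 < √(1 + ‖d⁻¹ • y‖ ^ 2) := by positivity
  field_simp

theorem integrable_div_sqrt {m : ℕ} {d : ℝ} (hd : 0 < d) :
    Integrable fun y : EuclideanSpace ℝ (Fin m) => d / √(d ^ 2 + ‖y‖ ^ 2) ^ (m + 1) := by
  simp_rw [div_sqrt_eq_rescaled hd]
  exact ((integrable_one_div_sqrt_one_add_norm_sq m).comp_smul (inv_ne_zero hd.ne')).const_mul _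

/-- A point at height `d` sees the disc of radius `δ` as the point at height `1` sees the disc of
radius `δ / d`. -/
theorem setIntegral_ball_div_sqrt {m : ℕ} {d : ℝ} (hd : 0 < d) (δ : ℝ) :
    ∫ y in Metric.ball (0 : EuclideanSpace ℝ (Fin m)) δ, d / √(d ^ 2 + ‖y‖ ^ 2) ^ (m + 1) =
      ∫ y in Metric.ball (0 : EuclideanSpace ℝ (Fin m)) (δ / d),
        1 / √(1 + ‖y‖ ^ 2) ^ (m + 1) := by
  simp_rw [div_sqrt_eq_rescaled hd]
  rw [integral_const_mul, Measure.setIntegral_comp_smul_of_pos volume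
    (fun y : EuclideanSpace ℝ (Fin m) => 1 / √(1 + ‖y‖ ^ 2) ^ (m + 1)) _ (inv_pos.2 hd),
    smul_ball (inv_ne_zero hd.ne'), smul_zero, Real.norm_of_nonneg (by positivity),
    finrank_euclideanSpace_fin, smul_eq_mul, inv_pow, inv_inv,
    inv_mul_cancel_left₀ (by positivity), inv_mul_eq_div]

theorem setIntegral_ball_div_sqrt_le {m : ℕ} {d : ℝ} (hd : 0 < d) (δ : ℝ) :
    ∫ y in Metric.ball (0 : EuclideanSpace ℝ (Fin m)) δ, d / √(d ^ 2 + ‖y‖ ^ 2) ^ (m + 1) ≤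
      halfSphereArea m := by
  rw [setIntegral_ball_div_sqrt hd, ← integral_one_div_sqrt_one_add_norm_sq]
  exact setIntegral_le_integral (integrable_one_div_sqrt_one_add_norm_sq m)
    (ae_of_all _ fun _ => by positivity)

theorem tendsto_setIntegral_ball_div_sqrt (m : ℕ) {δ : ℝ} (hδ : 0 < δ) :
    Tendsto (fun d : ℝ => ∫ y in Metric.ball (0 : EuclideanSpace ℝ (Fin m)) δ,
      d / √(d ^ 2 + ‖y‖ ^ 2) ^ (m + 1)) (𝓝[>] 0) (𝓝 (halfSphereArea m)) := by
  have h1 : Tendsto (fun d : ℝ => δ / d) (𝓝[>] 0) atTop :=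
    tendsto_inv_nhdsGT_zero.const_mul_atTop hδ
  have h2 := (aecover_ball (μ := (volume : Measure (EuclideanSpace ℝ (Fin m)))) (x := 0)
    h1).integral_tendsto_of_countably_generated (integrable_one_div_sqrt_one_add_norm_sq m)
  rw [integral_one_div_sqrt_one_add_norm_sq] at h2
  refine h2.congr' ?_
  filter_upwards [self_mem_nhdsWithin] with d hd
  exact (setIntegral_ball_div_sqrt hd δ).symm

theorem integrableOn_ball_inv_norm_pow {m : ℕ} (hm : 1 ≤ m) (δ : ℝ) :
    IntegrableOn (fun y : EuclideanSpace ℝ (Fin m) => (‖y‖ ^ (m - 1))⁻¹) (Metric.ball 0 δ) := by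
  have : Nontrivial (EuclideanSpace ℝ (Fin m)) := by
    refine Module.nontrivial_of_finrank_pos (R := ℝ) ?_
    rw [finrank_euclideanSpace_fin]; omega
  rw [← integrable_indicator_iff Metric.isOpen_ball.measurableSet]
  have h : (Metric.ball (0 : EuclideanSpace ℝ (Fin m)) δ).indicator (fun y => (‖y‖ ^ (m - 1))⁻¹) =
      fun y => (Set.Iio δ).indicator (fun r : ℝ => (r ^ (m - 1))⁻¹) ‖y‖ := by
    ext y; simp [Set.indicator]
  rw [h, integrable_fun_norm_addHaar, finrank_euclideanSpace_fin]
  have h3 : IntegrableOn ((Set.Iio δ).indicator fun _ : ℝ => (1 : ℝ)) (Set.Ioi 0) := by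
    rw [IntegrableOn, integrable_indicator_iff measurableSet_Iio, IntegrableOn,
      Measure.restrict_restrict measurableSet_Iio, Set.Iio_inter_Ioi]
    exact integrableOn_const (by simp)
  refine h3.congr_fun (fun r hr => ?_) measurableSet_Ioi
  have hr : (0 : ℝ) < r := hr
  by_cases h4 : r < δ
  · simp [h4, hr.ne']
  · simp [h4]

/-- In polar coordinates the density `‖y‖^(1-m)` is constant in the radius. -/
theorem setIntegral_ball_inv_norm_pow {m : ℕ} (hm : 1 ≤ m) {δ : ℝ} (hδ : 0 < δ) :
    ∫ y in Metric.ball (0 : EuclideanSpace ℝ (Fin m)) δ, (‖y‖ ^ (m - 1))⁻¹ =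
      (m * (volume : Measure (EuclideanSpace ℝ (Fin m))).real (Metric.ball 0 1)) * δ := by
  have : Nontrivial (EuclideanSpace ℝ (Fin m)) := by
    refine Module.nontrivial_of_finrank_pos (R := ℝ) ?_
    rw [finrank_euclideanSpace_fin]; omega
  rw [← integral_indicator Metric.isOpen_ball.measurableSet]
  have h : (Metric.ball (0 : EuclideanSpace ℝ (Fin m)) δ).indicator (fun y => (‖y‖ ^ (m - 1))⁻¹) =
      fun y => (Set.Iio δ).indicator (fun r : ℝ => (r ^ (m - 1))⁻¹) ‖y‖ := by
    ext y; simp [Set.indicator]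
  rw [h, integral_fun_norm_addHaar, finrank_euclideanSpace_fin]
  have h3 : ∫ r in Set.Ioi (0 : ℝ), r ^ (m - 1) • (Set.Iio δ).indicator
      (fun r : ℝ => (r ^ (m - 1))⁻¹) r =
      ∫ r in Set.Ioi (0 : ℝ), (Set.Iio δ).indicator (fun _ : ℝ => (1 : ℝ)) r := by
    refine setIntegral_congr_fun measurableSet_Ioi fun r hr => ?_
    have hr : (0 : ℝ) < r := hr
    by_cases h4 : r < δ
    · simp [h4, hr.ne']
    · simp [h4]
  rw [h3, integral_indicator measurableSet_Iio, Measure.restrict_restrict measurableSet_Iio,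
    Set.Iio_inter_Ioi]
  simp [hδ.le, mul_assoc]

/-! ### Comparison of surface integrals with flat integrals -/

section Transfer

variable {Y : Type*} [EMetricSpace Y] [MeasurableSpace Y] [BorelSpace Y] {m : ℕ}
  {ψ : EuclideanSpace ℝ (Fin m) → Y} {s : Set (EuclideanSpace ℝ (Fin m))} {f : Y → ℝ}

theorem integrableOn_image_of_lipschitzOn (hψ : Measurable ψ) {K : NNReal}
    (h : LipschitzOnWith K ψ s) (hf : Measurable f) (hint : IntegrableOn (fun y => f (ψ y)) s) :
    IntegrableOn f (ψ '' s) μHE[m] := by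
  have h1 : Integrable f ((volume.restrict s).map ψ) :=
    (integrable_map_measure hf.aestronglyMeasurable hψ.aemeasurable).2 hint
  exact (h1.smul_measure (by simp)).mono_measure (restrict_image_le_map_of_lipschitzOn hψ h)

/-- Surface integrals of nonnegative functions are bounded by integrals over the parameter domain,
with the factor `K ^ m` of the volume distortion. -/
theorem setIntegral_image_le_of_lipschitzOn (hψ : Measurable ψ) {K : NNReal}
    (h : LipschitzOnWith K ψ s) (hs : MeasurableSet s) (hf : Measurable f)
    (hint : IntegrableOn (fun y => f (ψ y)) s) (h0 : ∀ y ∈ s, 0 ≤ f (ψ y)) :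
    ∫ x in ψ '' s, f x ∂μHE[m] ≤ (K : ℝ) ^ m * ∫ y in s, f (ψ y) := by
  have h1 : Integrable f ((volume.restrict s).map ψ) :=
    (integrable_map_measure hf.aestronglyMeasurable hψ.aemeasurable).2 hint
  have h2 : 0 ≤ᵐ[(volume.restrict s).map ψ] f := by
    refine (ae_map_iff hψ.aemeasurable (measurableSet_le measurable_const hf)).2 ?_
    filter_upwards [ae_restrict_mem hs] with y hy using h0 y hy
  refine (integral_mono_measure (restrict_image_le_map_of_lipschitzOn hψ h)
    (Measure.ae_smul_measure h2 _) (h1.smul_measure (by simp))).trans_eq ?_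
  rw [integral_smul_measure, integral_map hψ.aemeasurable hf.aestronglyMeasurable]
  simp

theorem setIntegral_le_image_of_antilipschitz (hψ : Measurable ψ) (h : AntilipschitzWith 1 ψ)
    (hf : Measurable f) (hint : IntegrableOn f (ψ '' s) μHE[m])
    (h0 : 0 ≤ᵐ[μHE[m].restrict (ψ '' s)] f) :
    ∫ y in s, f (ψ y) ≤ ∫ x in ψ '' s, f x ∂μHE[m] := by
  rw [← integral_map hψ.aemeasurable hf.aestronglyMeasurable]
  exact integral_mono_measure (map_restrict_volume_le_of_antilipschitz hψ h s) h0 hint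

end Transfer

/-! ### The kernel seen from a point outside the sphere -/

section Kernel

variable {V : Type*} [NormedAddCommGroup V] [InnerProductSpace ℝ V] {x₀ e x : V} {R t : ℝ}

theorem inner_sub_eq_of_mem_sphere (he : ‖e‖ = 1) (hR : 0 < R) (hx : x ∈ Metric.sphere x₀ R) :
    inner ℝ (x₀ + t • e - x) e = (t - R) + ‖x - (x₀ + R • e)‖ ^ 2 / (2 * R) := by
  rw [mem_sphere_iff_norm] at hx
  have h1 : x - (x₀ + R • e) = (x - x₀) - R • e := by abel
  have h2 : x₀ + t • e - x = t • e - (x - x₀) := by abel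
  rw [h1, h2, norm_sub_sq_real, hx, norm_smul, he, inner_smul_right, inner_sub_left,
    inner_smul_left, real_inner_self_eq_norm_sq, he, Real.norm_of_nonneg hR.le]
  simp
  field_simp
  ring

theorem norm_sub_sq_of_mem_sphere (he : ‖e‖ = 1) (hR : 0 < R) (hx : x ∈ Metric.sphere x₀ R) :
    ‖x - (x₀ + t • e)‖ ^ 2 = (t - R) ^ 2 + t / R * ‖x - (x₀ + R • e)‖ ^ 2 := by
  rw [mem_sphere_iff_norm] at hx
  have h1 (c : ℝ) : x - (x₀ + c • e) = (x - x₀) - c • e := by abel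
  rw [h1, h1, norm_sub_sq_real (x - x₀), norm_sub_sq_real (x - x₀), hx, norm_smul, norm_smul, he,
    inner_smul_right, inner_smul_right, mul_one, mul_one, Real.norm_eq_abs, Real.norm_eq_abs, sq_abs, sq_abs]
  field_simp
  ring

theorem inner_sub_nonneg_of_mem_sphere (he : ‖e‖ = 1) (hR : 0 < R) (ht : R < t)
    (hx : x ∈ Metric.sphere x₀ R) : 0 ≤ inner ℝ (x₀ + t • e - x) e := by
  rw [inner_sub_eq_of_mem_sphere he hR hx]
  have : 0 ≤ t - R := by linarith
  positivity

/-- Moving radially away from the sphere increases the distance to its points. -/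
theorem norm_sub_le_of_mem_sphere (he : ‖e‖ = 1) (hR : 0 < R) (ht : R < t)
    (hx : x ∈ Metric.sphere x₀ R) : ‖x - (x₀ + R • e)‖ ≤ ‖x - (x₀ + t • e)‖ := by
  refine le_of_sq_le_sq ?_ (norm_nonneg _)
  rw [norm_sub_sq_of_mem_sphere he hR hx (t := t)]
  have : 1 ≤ t / R := by rw [le_div_iff₀ hR]; linarith
  nlinarith [sq_nonneg (t - R), sq_nonneg ‖x - (x₀ + R • e)‖]

theorem sub_le_norm_sub_of_mem_sphere (he : ‖e‖ = 1) (hR : 0 < R) (ht : R < t)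
    (hx : x ∈ Metric.sphere x₀ R) : t - R ≤ ‖x - (x₀ + t • e)‖ := by
  refine le_of_sq_le_sq ?_ (norm_nonneg _)
  rw [norm_sub_sq_of_mem_sphere he hR hx (t := t)]
  have : 0 < t := hR.trans ht
  have : 0 ≤ t / R * ‖x - (x₀ + R • e)‖ ^ 2 := by positivity
  linarith

/-- If `x` projects to a point of the hyperplane at distance `b` from the origin, its kernel is at
most the flat kernel plus an integrable error from the curvature of the sphere. The hypothesis `hb0`
is there because `(b ^ (m - 1))⁻¹` has the junk value `0` at `b = 0` when `m > 1`. -/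
theorem axialKernel_le (he : ‖e‖ = 1) (hR : 0 < R) (ht : R < t) (hx : x ∈ Metric.sphere x₀ R)
    {m : ℕ} (hm : 1 ≤ m) {b : ℝ} (hb : 0 ≤ b) (hbx : b ≤ ‖x - (x₀ + R • e)‖)
    (hb0 : b = 0 → ‖x - (x₀ + R • e)‖ = 0) :
    inner ℝ (x₀ + t • e - x) e / ‖x - (x₀ + t • e)‖ ^ (m + 1) ≤
      (t - R) / √((t - R) ^ 2 + b ^ 2) ^ (m + 1) + (b ^ (m - 1))⁻¹ / (2 * R) := by
  have hd : 0 < t - R := by linarith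
  have h1 := norm_sub_le_of_mem_sphere he hR ht hx
  have h2 : √((t - R) ^ 2 + b ^ 2) ≤ ‖x - (x₀ + t • e)‖ := by
    refine Real.sqrt_le_iff.2 ⟨norm_nonneg _, ?_⟩
    rw [norm_sub_sq_of_mem_sphere he hR hx (t := t)]
    have h3 : 1 ≤ t / R := by rw [le_div_iff₀ hR]; linarith
    have h4 : b ^ 2 ≤ ‖x - (x₀ + R • e)‖ ^ 2 := by gcongr
    nlinarith
  have hpos : 0 < √((t - R) ^ 2 + b ^ 2) := by positivity
  rw [inner_sub_eq_of_mem_sphere he hR hx, add_div]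
  refine add_le_add (by gcongr) ?_
  set q := ‖x - (x₀ + R • e)‖
  set N := ‖x - (x₀ + t • e)‖
  rw [div_right_comm]
  refine div_le_div_of_nonneg_right ?_ (by positivity)
  rcases hb.eq_or_lt with rfl | hb
  · rw [hb0 rfl]
    simp
  · have hq : 0 < q := hb.trans_le hbx
    calc q ^ 2 / N ^ (m + 1) ≤ q ^ 2 / q ^ (m + 1) := by gcongr
      _ = (q ^ (m - 1))⁻¹ := by
          have : m + 1 = 2 + (m - 1) := by omega
          rw [this, pow_add]
          field_simp
      _ ≤ (b ^ (m - 1))⁻¹ := by gcongr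

/-- Stretching the flat picture by the factor `t / R * L ≥ 1` in every direction only increases the
distance to the outer point; dropping the curvature term then bounds the kernel from below. -/
theorem le_axialKernel (he : ‖e‖ = 1) (hR : 0 < R) (ht : R < t) (hx : x ∈ Metric.sphere x₀ R)
    (m : ℕ) {b L : ℝ} (hL : 1 ≤ L) (hbx : ‖x - (x₀ + R • e)‖ ≤ L * b) :
    (t / R * L) ^ (-(m + 1 : ℤ)) * ((t - R) / √((t - R) ^ 2 + b ^ 2) ^ (m + 1)) ≤
      inner ℝ (x₀ + t • e - x) e / ‖x - (x₀ + t • e)‖ ^ (m + 1) := by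
  have hd : 0 < t - R := by linarith
  have h3 : 1 ≤ t / R := by rw [le_div_iff₀ hR]; linarith
  have hN : 0 < ‖x - (x₀ + t • e)‖ := hd.trans_le (sub_le_norm_sub_of_mem_sphere he hR ht hx)
  have h2 : ‖x - (x₀ + t • e)‖ ≤ (t / R * L) * √((t - R) ^ 2 + b ^ 2) := by
    refine le_of_sq_le_sq ?_ (by positivity)
    rw [norm_sub_sq_of_mem_sphere he hR hx (t := t), mul_pow, Real.sq_sqrt (by positivity)]
    have h4 : ‖x - (x₀ + R • e)‖ ^ 2 ≤ L ^ 2 * b ^ 2 := by rw [← mul_pow]; gcongr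
    have h5 : 1 ≤ t / R * L := one_le_mul_of_one_le_of_one_le h3 hL
    have h6 : t / R * ‖x - (x₀ + R • e)‖ ^ 2 ≤ (t / R) ^ 2 * (L ^ 2 * b ^ 2) := by
      refine mul_le_mul ?_ h4 (by positivity) (by positivity)
      nlinarith
    have h7 : (t - R) ^ 2 ≤ (t / R * L) ^ 2 * (t - R) ^ 2 :=
      le_mul_of_one_le_left (by positivity) (one_le_pow₀ h5)
    nlinarith
  have hpos : 0 < √((t - R) ^ 2 + b ^ 2) := by positivity
  have hk : 0 < t / R * L := by positivity
  have h8 : (t / R * L) ^ (-(m + 1 : ℤ)) * ((t - R) / √((t - R) ^ 2 + b ^ 2) ^ (m + 1)) =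
      (t - R) / ((t / R * L) * √((t - R) ^ 2 + b ^ 2)) ^ (m + 1) := by
    rw [zpow_neg, mul_pow]
    norm_cast
    field_simp
  rw [h8, inner_sub_eq_of_mem_sphere he hR hx]
  gcongr
  have : 0 ≤ ‖x - (x₀ + R • e)‖ ^ 2 / (2 * R) := by positivity
  linarith

end Kernel

/-! ### Integrals over spherical caps -/

section Cap

variable {m : ℕ} {x₀ e : EuclideanSpace ℝ (Fin (m + 1))} {R t δ : ℝ}

theorem measurableSet_sphere_inter_ball (x₀ p : EuclideanSpace ℝ (Fin (m + 1))) (R δ : ℝ) :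
    MeasurableSet (Metric.sphere x₀ R ∩ Metric.ball p δ) :=
  Metric.isClosed_sphere.measurableSet.inter Metric.isOpen_ball.measurableSet

/-- A bound for the surface measure of a spherical cap of radius `δ`. -/
noncomputable def capAreaBound (m : ℕ) (R δ : ℝ) : ℝ :=
  (chartConst R δ : ℝ) ^ m *
    (volume : Measure (EuclideanSpace ℝ (Fin m))).real (Metric.ball 0 δ)

theorem measure_sphere_inter_ball_le (he : ‖e‖ = 1) (hR : 0 < R) (hδ : 0 < δ) (hδR : δ < R) :
    μHE[m] (Metric.sphere x₀ R ∩ Metric.ball (x₀ + R • e) δ) ≤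
      ENNReal.ofReal (capAreaBound m R δ) := by
  obtain ⟨j, hj, hjr⟩ := exists_linearIsometry_orthogonal he
  refine (measure_mono (sphere_inter_ball_subset_image he hj hjr hR hδR.le)).trans ?_
  refine ((lipschitzOnWith_sphereChart he hj hR hδ
    hδR).euclideanHausdorffMeasure_image_le m).trans_eq ?_
  rw [EuclideanSpace.euclideanHausdorffMeasure_eq_volume, capAreaBound,
    ENNReal.ofReal_mul (by positivity), ofReal_measureReal measure_ball_lt_top.ne,
    ENNReal.ofReal_pow (by positivity), ENNReal.ofReal_coe_nnreal]

theorem measurable_kernel (α v : EuclideanSpace ℝ (Fin (m + 1))) :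
    Measurable fun x => inner ℝ (α - x) v / ‖x - α‖ ^ (m + 1) := by
  fun_prop

/-- A bound, uniform in the position of the outer point, for the axial part of the flatness
integral over a cap of radius `δ`. -/
noncomputable def axialBound (m : ℕ) (R δ : ℝ) : ℝ :=
  (chartConst R δ : ℝ) ^ m * (halfSphereArea m +
    m * (volume : Measure (EuclideanSpace ℝ (Fin m))).real (Metric.ball 0 1) * δ / (2 * R))

/-- The chart is defined on the disc of radius `δ`, whose image contains the cap because the
projection to the tangent hyperplane shortens distances to the centre of the cap. -/
theorem integrableOn_axialKernel_and_setIntegral_le (hm : 1 ≤ m) (he : ‖e‖ = 1) (hR : 0 < R)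
    (ht : R < t) (hδ : 0 < δ) (hδR : δ < R) :
    IntegrableOn (fun x => inner ℝ (x₀ + t • e - x) e / ‖x - (x₀ + t • e)‖ ^ (m + 1))
      (Metric.sphere x₀ R ∩ Metric.ball (x₀ + R • e) δ) μHE[m] ∧
    ∫ x in Metric.sphere x₀ R ∩ Metric.ball (x₀ + R • e) δ,
      inner ℝ (x₀ + t • e - x) e / ‖x - (x₀ + t • e)‖ ^ (m + 1) ∂μHE[m] ≤
      axialBound m R δ := by
  obtain ⟨j, hj, hjr⟩ := exists_linearIsometry_orthogonal he
  set ψ := sphereChart x₀ R e j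
  set B : Set (EuclideanSpace ℝ (Fin m)) := Metric.ball 0 δ
  set f : EuclideanSpace ℝ (Fin (m + 1)) → ℝ :=
    fun x => inner ℝ (x₀ + t • e - x) e / ‖x - (x₀ + t • e)‖ ^ (m + 1)
  have hd : 0 < t - R := by linarith
  have hsub := sphere_inter_ball_subset_image (x₀ := x₀) he hj hjr hR hδR.le
  have hS : ψ '' B ⊆ Metric.sphere x₀ R := image_sphereChart_subset_sphere he hj hR hδR.le
  have hψ : Measurable ψ := continuous_sphereChart.measurable
  have hf : Measurable f := measurable_kernel _ _
  have hLip := lipschitzOnWith_sphereChart (x₀ := x₀) he hj hR hδ hδR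
  have hB : MeasurableSet B := Metric.isOpen_ball.measurableSet
  have hf0 : ∀ x ∈ Metric.sphere x₀ R, 0 ≤ f x := fun x hx =>
    div_nonneg (inner_sub_nonneg_of_mem_sphere he hR ht hx) (by positivity)
  have hψ0 : ψ 0 = x₀ + R • e := sphereChart_zero hR.le
  have hle : ∀ y ∈ B, f (ψ y) ≤ (t - R) / √((t - R) ^ 2 + ‖y‖ ^ 2) ^ (m + 1) +
      (‖y‖ ^ (m - 1))⁻¹ / (2 * R) := by
    intro y hy
    refine axialKernel_le he hR ht (hS ⟨y, hy, rfl⟩) hm (norm_nonneg _) ?_ fun h => ?_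
    · have := (antilipschitzWith_sphereChart (x₀ := x₀) (R := R) he hj).le_mul_dist y 0
      rwa [NNReal.coe_one, one_mul, dist_zero_right, sphereChart_zero hR.le, dist_eq_norm] at this
    · rw [norm_eq_zero] at h
      rw [h, hψ0, sub_self, norm_zero]
  have hg : IntegrableOn (fun y : EuclideanSpace ℝ (Fin m) =>
      (t - R) / √((t - R) ^ 2 + ‖y‖ ^ 2) ^ (m + 1) + (‖y‖ ^ (m - 1))⁻¹ / (2 * R)) B :=
    (integrable_div_sqrt hd).integrableOn.add ((integrableOn_ball_inv_norm_pow hm δ).div_const _)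
  have hfint : IntegrableOn (fun y => f (ψ y)) B := by
    refine Integrable.mono' hg (hf.comp hψ).aestronglyMeasurable ?_
    filter_upwards [ae_restrict_mem hB] with y hy
    rw [Real.norm_of_nonneg (hf0 _ (hS ⟨y, hy, rfl⟩))]
    exact hle y hy
  have hfi : IntegrableOn f (ψ '' B) μHE[m] := integrableOn_image_of_lipschitzOn hψ hLip hf hfint
  refine ⟨hfi.mono_set hsub, ?_⟩
  calc ∫ x in Metric.sphere x₀ R ∩ Metric.ball (x₀ + R • e) δ, f x ∂μHE[m]
      ≤ ∫ x in ψ '' B, f x ∂μHE[m] := by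
        refine setIntegral_mono_set hfi ?_ hsub.eventuallyLE
        refine ae_mono (Measure.restrict_mono hS le_rfl) ?_
        filter_upwards [ae_restrict_mem Metric.isClosed_sphere.measurableSet] with x hx
        exact hf0 x hx
    _ ≤ (chartConst R δ : ℝ) ^ m * ∫ y in B, f (ψ y) :=
        setIntegral_image_le_of_lipschitzOn hψ hLip hB hf hfint
          fun y hy => hf0 _ (hS ⟨y, hy, rfl⟩)
    _ ≤ axialBound m R δ := by
        refine mul_le_mul_of_nonneg_left ?_ (by positivity)
        refine (setIntegral_mono_on hfint hg hB hle).trans ?_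
        rw [integral_add (integrable_div_sqrt hd).integrableOn
          ((integrableOn_ball_inv_norm_pow hm δ).div_const _), integral_div,
          setIntegral_ball_inv_norm_pow hm hδ]
        gcongr
        exact setIntegral_ball_div_sqrt_le hd δ

/-- The cap has twice the radius of the disc, because the chart has Lipschitz constant at most `2`
there. -/
theorem le_setIntegral_axialKernel (hm : 1 ≤ m) (he : ‖e‖ = 1) (hR : 0 < R)
    (ht : R < t) (hδ : 0 < δ) (hδR : 2 * δ < R) :
    (t / R * chartConst R δ) ^ (-(m + 1 : ℤ)) *
      ∫ y in Metric.ball (0 : EuclideanSpace ℝ (Fin m)) δ,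
        (t - R) / √((t - R) ^ 2 + ‖y‖ ^ 2) ^ (m + 1) ≤
    ∫ x in Metric.sphere x₀ R ∩ Metric.ball (x₀ + R • e) (2 * δ),
      inner ℝ (x₀ + t • e - x) e / ‖x - (x₀ + t • e)‖ ^ (m + 1) ∂μHE[m] := by
  obtain ⟨j, hj, hjr⟩ := exists_linearIsometry_orthogonal he
  have hint := (integrableOn_axialKernel_and_setIntegral_le (x₀ := x₀) hm he hR ht
    (by positivity : 0 < 2 * δ) hδR).1
  set ψ := sphereChart x₀ R e j
  set B : Set (EuclideanSpace ℝ (Fin m)) := Metric.ball 0 δ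
  set f : EuclideanSpace ℝ (Fin (m + 1)) → ℝ :=
    fun x => inner ℝ (x₀ + t • e - x) e / ‖x - (x₀ + t • e)‖ ^ (m + 1)
  have hd : 0 < t - R := by linarith
  have hS : ψ '' B ⊆ Metric.sphere x₀ R :=
    image_sphereChart_subset_sphere he hj hR (by linarith)
  have hψ : Measurable ψ := continuous_sphereChart.measurable
  have hf : Measurable f := measurable_kernel _ _
  have hLip := lipschitzOnWith_sphereChart (x₀ := x₀) he hj hR hδ (by linarith)
  have hB : MeasurableSet B := Metric.isOpen_ball.measurableSet
  have hf0 : ∀ x ∈ Metric.sphere x₀ R, 0 ≤ f x := fun x hx =>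
    div_nonneg (inner_sub_nonneg_of_mem_sphere he hR ht hx) (by positivity)
  have hf0' : 0 ≤ᵐ[μHE[m].restrict (Metric.sphere x₀ R)] f := by
    filter_upwards [ae_restrict_mem Metric.isClosed_sphere.measurableSet] with x hx
    exact hf0 x hx
  have hψ0 : ψ 0 = x₀ + R • e := sphereChart_zero hR.le
  have hdist : ∀ y ∈ B, ‖ψ y - (x₀ + R • e)‖ ≤ chartConst R δ * ‖y‖ := by
    intro y hy
    have := hLip.dist_le_mul y hy 0 (Metric.mem_ball_self hδ)
    rwa [dist_zero_right, sphereChart_zero hR.le, dist_eq_norm] at this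
  have hc : 0 < R ^ 2 - δ ^ 2 := by nlinarith
  have hL1 : 1 ≤ (chartConst R δ : ℝ) := by
    rw [coe_chartConst hR, le_div_iff₀ (by positivity), one_mul]
    exact Real.sqrt_le_iff.2 ⟨hR.le, by nlinarith⟩
  -- `δ ≤ R / 2` gives `√(R² - δ²) ≥ R / 2`
  have hL2 : (chartConst R δ : ℝ) ≤ 2 := by
    rw [coe_chartConst hR, div_le_iff₀ (by positivity), ← div_le_iff₀' two_pos]
    exact Real.le_sqrt_of_sq_le (by nlinarith)
  have hsub : ψ '' B ⊆ Metric.sphere x₀ R ∩ Metric.ball (x₀ + R • e) (2 * δ) := by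
    refine Set.subset_inter hS ?_
    rintro _ ⟨y, hy, rfl⟩
    rw [mem_ball_iff_norm]
    have h1 := hdist y hy
    rw [mem_ball_zero_iff] at hy
    nlinarith [norm_nonneg y]
  have hfi : IntegrableOn f (ψ '' B) μHE[m] := hint.mono_set hsub
  have hf0B : 0 ≤ᵐ[μHE[m].restrict (ψ '' B)] f :=
    ae_mono (Measure.restrict_mono hS le_rfl) hf0'
  have hfint : IntegrableOn (fun y => f (ψ y)) B := by
    have h1 : Integrable f ((volume.restrict B).map ψ) := Integrable.mono_measure hfi
      (map_restrict_volume_le_of_antilipschitz hψ (antilipschitzWith_sphereChart he hj) B)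
    exact (integrable_map_measure hf.aestronglyMeasurable hψ.aemeasurable).1 h1
  calc _ = ∫ y in B, (t / R * chartConst R δ) ^ (-(m + 1 : ℤ)) *
        ((t - R) / √((t - R) ^ 2 + ‖y‖ ^ 2) ^ (m + 1)) := (integral_const_mul _ _).symm
    _ ≤ ∫ y in B, f (ψ y) :=
        setIntegral_mono_on ((integrable_div_sqrt hd).integrableOn.const_mul _) hfint hB
          fun y hy => le_axialKernel he hR ht (hS ⟨y, hy, rfl⟩) m hL1 (hdist y hy)
    _ ≤ ∫ x in ψ '' B, f x ∂μHE[m] := setIntegral_le_image_of_antilipschitz hψ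
        (antilipschitzWith_sphereChart he hj) hf hfi hf0B
    _ ≤ _ := setIntegral_mono_set hint
        (ae_mono (Measure.restrict_mono Set.inter_subset_left le_rfl) hf0') hsub.eventuallyLE

/-- The component of the kernel orthogonal to the axis cancels over a cap centred on the axis, by
reflection in the axis. -/
theorem setIntegral_transversalKernel_eq_zero {w : EuclideanSpace ℝ (Fin (m + 1))}
    (hw : inner ℝ w e = 0) (s : ℝ) (x₀ : EuclideanSpace ℝ (Fin (m + 1))) (R t δ : ℝ) :
    ∫ x in Metric.sphere x₀ R ∩ Metric.ball (x₀ + s • e) δ,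
      inner ℝ (x₀ + t • e - x) w / ‖x - (x₀ + t • e)‖ ^ (m + 1) ∂μHE[m] = 0 := by
  let r := (ℝ ∙ e).reflection
  let T : EuclideanSpace ℝ (Fin (m + 1)) ≃ᵢ EuclideanSpace ℝ (Fin (m + 1)) :=
    (IsometryEquiv.subRight x₀).trans (r.toIsometryEquiv.trans (IsometryEquiv.addRight x₀))
  have hr (c : ℝ) : r (c • e) = c • e :=
    Submodule.reflection_mem_subspace_eq_self
      (Submodule.smul_mem _ _ (Submodule.mem_span_singleton_self e))
  have hrw : r w = -w := Submodule.reflection_mem_subspace_orthogonalComplement_eq_neg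
    (Submodule.mem_orthogonal_singleton_iff_inner_left.2 hw)
  have hT (c : ℝ) (x) : T x - (x₀ + c • e) = r (x - (x₀ + c • e)) := by
    rw [← sub_sub x, map_sub r _ (c • e), hr]
    simp [T]
    abel
  have hT0 (x) : T x - x₀ = r (x - x₀) := by simp [T]
  have hpre : T ⁻¹' (Metric.sphere x₀ R ∩ Metric.ball (x₀ + s • e) δ) =
      Metric.sphere x₀ R ∩ Metric.ball (x₀ + s • e) δ := by
    ext x
    simp only [Set.mem_preimage, Set.mem_inter_iff, mem_sphere_iff_norm, mem_ball_iff_norm, hT,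
      hT0, LinearIsometryEquiv.norm_map]
  have h := (T.measurePreserving_euclideanHausdorffMeasure m).setIntegral_preimage_emb
    T.toHomeomorph.measurableEmbedding
    (fun x => inner ℝ (x₀ + t • e - x) w / ‖x - (x₀ + t • e)‖ ^ (m + 1))
    (Metric.sphere x₀ R ∩ Metric.ball (x₀ + s • e) δ)
  have hneg (x) : inner ℝ (x₀ + t • e - T x) w / ‖T x - (x₀ + t • e)‖ ^ (m + 1) =
      -(inner ℝ (x₀ + t • e - x) w / ‖x - (x₀ + t • e)‖ ^ (m + 1)) := by
    have h1 : inner ℝ (x₀ + t • e - T x) w = -inner ℝ (x₀ + t • e - x) w := by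
      rw [← neg_sub, hT, ← map_neg, neg_sub, ← neg_eq_iff_eq_neg, ← inner_neg_right, ← hrw,
        LinearIsometryEquiv.inner_map_map]
    rw [h1, hT, LinearIsometryEquiv.norm_map, neg_div]
  rw [hpre] at h
  simp_rw [hneg] at h
  rw [integral_neg] at h
  linarith

end Cap

/-! ### The flatness integral of a sphere -/

section Flatness

variable {m : ℕ} {x₀ x₁ z e w : EuclideanSpace ℝ (Fin (m + 1))} {R t a ρ : ℝ}

/-- A bound for the integral of the transversal kernel, per unit length of the transversal vector,
over the part of the sphere at distance between `ρ / 2` and `2 * ρ` from the centre of the cap. -/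
noncomputable def transversalBound (m : ℕ) (R ρ : ℝ) : ℝ :=
  ((ρ / 2) ^ m)⁻¹ * capAreaBound m R (2 * ρ)

/-- Only the part of `B(z, ρ)` outside a smaller cap centred on the axis contributes to the integral
of the transversal kernel, and there the kernel is bounded uniformly in the outer point. -/
theorem abs_setIntegral_transversalKernel_le (he : ‖e‖ = 1) (hw : inner ℝ w e = 0)
    (hR : 0 < R) (ht : R < t) (hρ : 0 < ρ) (hρR : 2 * ρ < R) (hz : ‖z - (x₀ + R • e)‖ < ρ / 2) :
    IntegrableOn (fun x => inner ℝ (x₀ + t • e - x) w / ‖x - (x₀ + t • e)‖ ^ (m + 1))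
      (Metric.sphere x₀ R ∩ Metric.ball z ρ) μHE[m] ∧
    |∫ x in Metric.sphere x₀ R ∩ Metric.ball z ρ,
      inner ℝ (x₀ + t • e - x) w / ‖x - (x₀ + t • e)‖ ^ (m + 1) ∂μHE[m]| ≤
      ‖w‖ * transversalBound m R ρ := by
  have hd : 0 < t - R := by linarith
  set f : EuclideanSpace ℝ (Fin (m + 1)) → ℝ :=
    fun x => inner ℝ (x₀ + t • e - x) w / ‖x - (x₀ + t • e)‖ ^ (m + 1)
  set S := Metric.sphere x₀ R
  have hdz : dist z (x₀ + R • e) < ρ / 2 := by rwa [dist_eq_norm]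
  have hsub1 : S ∩ Metric.ball (x₀ + R • e) (ρ / 2) ⊆ S ∩ Metric.ball z ρ :=
    Set.inter_subset_inter_right _ (Metric.ball_subset_ball' (by rw [dist_comm]; linarith))
  have hsub2 : S ∩ Metric.ball z ρ ⊆ S ∩ Metric.ball (x₀ + R • e) (2 * ρ) :=
    Set.inter_subset_inter_right _ (Metric.ball_subset_ball' (by linarith))
  have hmeas := measure_sphere_inter_ball_le (m := m) (x₀ := x₀) he hR
    (by positivity : 0 < 2 * ρ) hρR
  have hfin : μHE[m] (S ∩ Metric.ball z ρ) < ⊤ :=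
    ((measure_mono hsub2).trans hmeas).trans_lt ENNReal.ofReal_lt_top
  have hf (x) : ‖f x‖ ≤ ‖w‖ * (‖x - (x₀ + t • e)‖ ^ m)⁻¹ := by
    rw [norm_div, norm_pow, norm_norm]
    rcases (norm_nonneg (x - (x₀ + t • e))).eq_or_lt with h | h
    · rw [← h, zero_pow (by omega), div_zero]
      positivity
    · rw [← div_eq_mul_inv, div_le_div_iff₀ (by positivity) (by positivity), pow_succ]
      have := norm_inner_le_norm (𝕜 := ℝ) (x₀ + t • e - x) w
      rw [norm_sub_rev] at this
      calc _ ≤ (‖x - (x₀ + t • e)‖ * ‖w‖) * ‖x - (x₀ + t • e)‖ ^ m := by gcongr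
        _ = _ := by ring
  have hint : IntegrableOn f (S ∩ Metric.ball z ρ) μHE[m] := by
    refine Measure.integrableOn_of_bounded (M := ‖w‖ * ((t - R) ^ m)⁻¹) hfin.ne
      (measurable_kernel _ _).aestronglyMeasurable ?_
    filter_upwards [ae_restrict_mem (measurableSet_sphere_inter_ball x₀ z R ρ)] with x hx
    refine (hf x).trans ?_
    have := sub_le_norm_sub_of_mem_sphere he hR ht hx.1
    gcongr
  refine ⟨hint, ?_⟩
  rw [← integral_inter_add_sdiff (measurableSet_sphere_inter_ball x₀ (x₀ + R • e) R (ρ / 2)) hint,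
    Set.inter_eq_self_of_subset_right hsub1, setIntegral_transversalKernel_eq_zero hw, zero_add]
  have hfin2 : μHE[m] ((S ∩ Metric.ball z ρ) \ (S ∩ Metric.ball (x₀ + R • e) (ρ / 2))) < ⊤ :=
    (measure_mono Set.sdiff_subset).trans_lt hfin
  have hb := norm_setIntegral_le_of_norm_le_const hfin2 (f := f)
    (C := ‖w‖ * ((ρ / 2) ^ m)⁻¹) (fun x hx => by
      refine (hf x).trans ?_
      have h1 : ρ / 2 ≤ ‖x - (x₀ + R • e)‖ := by
        by_contra! h
        exact hx.2 ⟨hx.1.1, mem_ball_iff_norm.2 h⟩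
      have := h1.trans (norm_sub_le_of_mem_sphere he hR ht hx.1.1)
      gcongr)
  rw [Real.norm_eq_abs] at hb
  refine hb.trans ?_
  rw [transversalBound, ← mul_assoc]
  refine mul_le_mul_of_nonneg_left ?_ (by positivity)
  refine ENNReal.toReal_le_of_le_ofReal (by unfold capAreaBound; positivity) ?_
  exact (measure_mono (Set.sdiff_subset.trans hsub2)).trans hmeas

/-- The two-sided estimate of the flatness integral at the outer point `α = x₀ + t • e`, where the
vector `α - x₁ = (t - a) • e - w` is split along the axis. -/
theorem flatnessIntegral_bounds (hm : 1 ≤ m) (he : ‖e‖ = 1) (hw : inner ℝ w e = 0)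
    (hx₁ : x₁ = x₀ + (a • e + w)) (hR : 0 < R) (ht : R < t) (hat : a ≤ t) (hρ : 0 < ρ)
    (hρR : 2 * ρ < R) (hz : ‖z - (x₀ + R • e)‖ < ρ / 2) :
    (t - a) * ((t / R * chartConst R (ρ / 4)) ^ (-(m + 1 : ℤ)) *
      ∫ y in Metric.ball (0 : EuclideanSpace ℝ (Fin m)) (ρ / 4),
        (t - R) / √((t - R) ^ 2 + ‖y‖ ^ 2) ^ (m + 1)) - ‖w‖ * transversalBound m R ρ ≤
      flatnessIntegral (Metric.ball x₀ R) x₁ z ρ (x₀ + t • e) ∧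
    flatnessIntegral (Metric.ball x₀ R) x₁ z ρ (x₀ + t • e) ≤
      (t - a) * axialBound m R (2 * ρ) + ‖w‖ * transversalBound m R ρ := by
  set S := Metric.sphere x₀ R
  set f : EuclideanSpace ℝ (Fin (m + 1)) → ℝ :=
    fun x => inner ℝ (x₀ + t • e - x) e / ‖x - (x₀ + t • e)‖ ^ (m + 1)
  obtain ⟨hgint, hg⟩ := abs_setIntegral_transversalKernel_le (m := m) he hw hR ht hρ hρR hz
  obtain ⟨hfint, hfle⟩ := integrableOn_axialKernel_and_setIntegral_le (x₀ := x₀) hm he hR ht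
    (by positivity : 0 < 2 * ρ) hρR
  have hlow := le_setIntegral_axialKernel (x₀ := x₀) hm he hR ht
    (by positivity : 0 < ρ / 4) (by linarith)
  have h4 : 2 * (ρ / 4) = ρ / 2 := by ring
  rw [h4] at hlow
  have hdz : dist z (x₀ + R • e) < ρ / 2 := by rwa [dist_eq_norm]
  have hsub1 : S ∩ Metric.ball (x₀ + R • e) (ρ / 2) ⊆ S ∩ Metric.ball z ρ :=
    Set.inter_subset_inter_right _ (Metric.ball_subset_ball' (by rw [dist_comm]; linarith))
  have hsub2 : S ∩ Metric.ball z ρ ⊆ S ∩ Metric.ball (x₀ + R • e) (2 * ρ) :=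
    Set.inter_subset_inter_right _ (Metric.ball_subset_ball' (by linarith))
  have hf0 (T : Set (EuclideanSpace ℝ (Fin (m + 1)))) :
      0 ≤ᵐ[μHE[m].restrict (S ∩ T)] f := by
    refine ae_mono (Measure.restrict_mono Set.inter_subset_left le_rfl) ?_
    filter_upwards [ae_restrict_mem Metric.isClosed_sphere.measurableSet] with x hx
    exact div_nonneg (inner_sub_nonneg_of_mem_sphere he hR ht hx) (by positivity)
  have hfint' := hfint.mono_set hsub2
  have hle1 := setIntegral_mono_set hfint' (hf0 _) hsub1.eventuallyLE
  have hle2 := setIntegral_mono_set hfint (hf0 _) hsub2.eventuallyLE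
  have hsplit : flatnessIntegral (Metric.ball x₀ R) x₁ z ρ (x₀ + t • e) =
      (t - a) * (∫ x in S ∩ Metric.ball z ρ, f x ∂μHE[m]) -
      ∫ x in S ∩ Metric.ball z ρ,
        inner ℝ (x₀ + t • e - x) w / ‖x - (x₀ + t • e)‖ ^ (m + 1) ∂μHE[m] := by
    rw [flatnessIntegral, frontier_ball _ hR.ne', ← integral_const_mul,
      ← integral_sub (hfint'.const_mul _) hgint]
    refine integral_congr_ae (ae_of_all _ fun x => ?_)
    have : x₀ + t • e - x₁ = (t - a) • e - w := by rw [hx₁, sub_smul]; abel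
    beta_reduce
    rw [this, inner_sub_right, inner_smul_right, sub_div, mul_div_assoc]
  rw [hsplit]
  have hta : 0 ≤ t - a := by linarith
  obtain ⟨hg1, hg2⟩ := abs_le.1 hg
  constructor
  · have := mul_le_mul_of_nonneg_left (hlow.trans hle1) hta
    linarith
  · have := mul_le_mul_of_nonneg_left (hle2.trans hfle) hta
    linarith

end Flatness

/-! ### The lower limits -/

section Limit

variable {m : ℕ} {x₀ x₁ z : EuclideanSpace ℝ (Fin (m + 1))} {R c : ℝ}

theorem tendsto_axialBound (m : ℕ) (hR : 0 < R) :
    Tendsto (fun ρ => axialBound m R (2 * ρ)) (𝓝[>] 0) (𝓝 (halfSphereArea m)) := by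
  have h2 : Tendsto (fun ρ : ℝ => 2 * ρ) (𝓝[>] 0) (𝓝 0) := by
    have : Continuous fun ρ : ℝ => 2 * ρ := by fun_prop
    simpa using (this.tendsto 0).mono_left nhdsWithin_le_nhds
  have h := (((tendsto_chartConst hR).comp h2).pow m).mul
    (((h2.const_mul ((m : ℝ) * (volume : Measure (EuclideanSpace ℝ (Fin m))).real
      (Metric.ball 0 1))).div_const (2 * R)).const_add (halfSphereArea m))
  simpa [axialBound, Function.comp_def] using h

theorem tendsto_chartConst_zpow (m : ℕ) (hR : 0 < R) :
    Tendsto (fun ρ => (chartConst R (ρ / 4) : ℝ) ^ (-(m + 1 : ℤ)) * halfSphereArea m) (𝓝[>] 0)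
      (𝓝 (halfSphereArea m)) := by
  have h2 : Tendsto (fun ρ : ℝ => ρ / 4) (𝓝[>] 0) (𝓝 0) := by
    have : Continuous fun ρ : ℝ => ρ / 4 := by fun_prop
    simpa using (this.tendsto 0).mono_left nhdsWithin_le_nhds
  have h := (((tendsto_chartConst hR).comp h2).zpow₀ (-(m + 1 : ℤ))
    (Or.inl one_ne_zero)).mul_const (halfSphereArea m)
  simpa [Function.comp_def] using h

theorem neBot_nhdsWithin_compl_closedBall (hR : 0 < R) (hz : z ∈ Metric.sphere x₀ R) :
    (𝓝[(closure (Metric.ball x₀ R))ᶜ] z).NeBot := by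
  rw [← mem_closure_iff_nhdsWithin_neBot, closure_ball _ hR.ne', closure_compl,
    interior_closedBall _ hR.ne', Set.mem_compl_iff, Metric.mem_ball, not_lt]
  exact (Metric.mem_sphere.1 hz).ge

/-- If `x₁` lies on the radius of `z`, the lower limit over the outer points is squeezed between two
multiples of half the area of the unit sphere that both approach `‖z - x₁‖ = (1 - c) * R`. -/
theorem liminf_flatnessIntegral_bounds (hm : 1 ≤ m) (hR : 0 < R) (hz : z ∈ Metric.sphere x₀ R)
    (hc : c < 1) (hx₁ : x₁ - x₀ = c • (z - x₀)) {ρ : ℝ} (hρ : 0 < ρ) (hρR : 2 * ρ < R) :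
    (((1 - c) * R * ((chartConst R (ρ / 4) : ℝ) ^ (-(m + 1 : ℤ)) * halfSphereArea m) : ℝ) : EReal) ≤
      liminf (fun α => (flatnessIntegral (Metric.ball x₀ R) x₁ z ρ α : EReal))
        (𝓝[(closure (Metric.ball x₀ R))ᶜ] z) ∧
    liminf (fun α => (flatnessIntegral (Metric.ball x₀ R) x₁ z ρ α : EReal))
        (𝓝[(closure (Metric.ball x₀ R))ᶜ] z) ≤
      (((1 - c) * R * axialBound m R (2 * ρ) : ℝ) : EReal) := by
  have hne := neBot_nhdsWithin_compl_closedBall hR hz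
  set l := 𝓝[(closure (Metric.ball x₀ R))ᶜ] z
  have hzn : ‖z - x₀‖ = R := mem_sphere_iff_norm.1 hz
  let t : EuclideanSpace ℝ (Fin (m + 1)) → ℝ := fun α => ‖α - x₀‖
  let e : EuclideanSpace ℝ (Fin (m + 1)) → EuclideanSpace ℝ (Fin (m + 1)) :=
    fun α => (t α)⁻¹ • (α - x₀)
  let a : EuclideanSpace ℝ (Fin (m + 1)) → ℝ := fun α => inner ℝ (x₁ - x₀) (e α)
  let w : EuclideanSpace ℝ (Fin (m + 1)) → EuclideanSpace ℝ (Fin (m + 1)) :=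
    fun α => x₁ - x₀ - a α • e α
  have ht : Tendsto t l (𝓝 R) := by
    have : Continuous t := by fun_prop
    have h := (this.tendsto z).mono_left (nhdsWithin_le_nhds (s := (closure (Metric.ball x₀ R))ᶜ))
    simpa only [t, hzn] using h
  have he : Tendsto e l (𝓝 (R⁻¹ • (z - x₀))) := by
    refine (ht.inv₀ hR.ne').smul ?_
    have : Continuous fun α : EuclideanSpace ℝ (Fin (m + 1)) => α - x₀ := by fun_prop
    exact (this.tendsto z).mono_left nhdsWithin_le_nhds
  have ha : Tendsto a l (𝓝 (c * R)) := by
    have h : Tendsto a l (𝓝 (inner ℝ (x₁ - x₀) (R⁻¹ • (z - x₀)))) := tendsto_const_nhds.inner he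
    have h2 : inner ℝ (x₁ - x₀) (R⁻¹ • (z - x₀)) = c * R := by
      rw [hx₁, inner_smul_left, inner_smul_right, real_inner_self_eq_norm_sq, hzn]
      simp only [conj_trivial]
      field_simp
    rwa [h2] at h
  have hw : Tendsto (fun α => ‖w α‖) l (𝓝 0) := by
    have h := (tendsto_const_nhds (x := x₁ - x₀)).sub (ha.smul he)
    have h2 : x₁ - x₀ - (c * R) • R⁻¹ • (z - x₀) = 0 := by
      rw [hx₁, smul_smul, mul_inv_cancel_right₀ hR.ne', sub_self]
    rw [h2] at h
    simpa using h.norm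
  have htR : ∀ᶠ α in l, R < t α := by
    filter_upwards [self_mem_nhdsWithin] with α hα
    rw [closure_ball _ hR.ne', Set.mem_compl_iff, mem_closedBall_iff_norm, not_le] at hα
    exact hα
  have hd : Tendsto (fun α => t α - R) l (𝓝[>] 0) := by
    refine tendsto_nhdsWithin_iff.2 ⟨by simpa using ht.sub_const R, ?_⟩
    filter_upwards [htR] with α hα
    exact sub_pos.2 hα
  have hta : Tendsto (fun α => t α - a α) l (𝓝 ((1 - c) * R)) := by
    have := ht.sub ha
    rwa [show R - c * R = (1 - c) * R by ring] at this
  have hzp : ∀ᶠ α in l, ‖z - (x₀ + R • e α)‖ < ρ / 2 := by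
    have h := ((tendsto_const_nhds (x := z)).sub
      ((he.const_smul R).const_add x₀)).norm
    have h2 : ‖z - (x₀ + R • R⁻¹ • (z - x₀))‖ = 0 := by
      rw [smul_inv_smul₀ hR.ne']; simp
    rw [h2] at h
    exact h.eventually_lt_const (by positivity)
  have hbounds : ∀ᶠ α in l,
      (t α - a α) * ((t α / R * chartConst R (ρ / 4)) ^ (-(m + 1 : ℤ)) *
        ∫ y in Metric.ball (0 : EuclideanSpace ℝ (Fin m)) (ρ / 4),
          (t α - R) / √((t α - R) ^ 2 + ‖y‖ ^ 2) ^ (m + 1)) - ‖w α‖ * transversalBound m R ρ ≤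
        flatnessIntegral (Metric.ball x₀ R) x₁ z ρ α ∧
      flatnessIntegral (Metric.ball x₀ R) x₁ z ρ α ≤
        (t α - a α) * axialBound m R (2 * ρ) + ‖w α‖ * transversalBound m R ρ := by
    filter_upwards [htR, hzp, hta.eventually_const_lt (mul_pos (sub_pos.2 hc) hR)]
      with α h1 h2 h3
    have htpos : 0 < t α := hR.trans h1
    have hen : ‖e α‖ = 1 := by
      simp only [e, norm_smul, norm_inv, Real.norm_of_nonneg htpos.le]
      exact inv_mul_cancel₀ htpos.ne'
    have hwe : inner ℝ (w α) (e α) = 0 := by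
      simp only [w]
      rw [inner_sub_left, inner_smul_left, real_inner_self_eq_norm_sq, hen]
      simp [a]
    have hα : x₀ + t α • e α = α := by
      simp only [e]
      rw [smul_inv_smul₀ htpos.ne']
      abel
    have h := flatnessIntegral_bounds hm hen hwe (x₁ := x₁) (x₀ := x₀) (z := z) (a := a α)
      (by simp [w]) hR h1 (by linarith) hρ hρR h2
    rw [hα] at h
    exact h
  have hJ := (tendsto_setIntegral_ball_div_sqrt m (by positivity : 0 < ρ / 4)).comp hd
  have hL : (chartConst R (ρ / 4) : ℝ) ≠ 0 := by
    rw [coe_chartConst hR]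
    have : 0 < R ^ 2 - (ρ / 4) ^ 2 := by nlinarith
    positivity
  have hκ : Tendsto (fun α => (t α / R * chartConst R (ρ / 4)) ^ (-(m + 1 : ℤ))) l
      (𝓝 ((chartConst R (ρ / 4) : ℝ) ^ (-(m + 1 : ℤ)))) := by
    have h := ((ht.div_const R).mul_const (chartConst R (ρ / 4) : ℝ))
    rw [div_self hR.ne', one_mul] at h
    exact h.zpow₀ _ (Or.inl hL)
  have hwb := hw.mul_const (transversalBound m R ρ)
  rw [zero_mul] at hwb
  have hlow := (hta.mul (hκ.mul hJ)).sub hwb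
  have hup := (hta.mul_const (axialBound m R (2 * ρ))).add hwb
  rw [sub_zero] at hlow
  rw [add_zero] at hup
  constructor
  · rw [← ((continuous_coe_real_ereal.tendsto _).comp hlow).liminf_eq]
    refine liminf_le_liminf ?_
    filter_upwards [hbounds] with α h
    exact EReal.coe_le_coe_iff.2 h.1
  · rw [← ((continuous_coe_real_ereal.tendsto _).comp hup).liminf_eq]
    refine liminf_le_liminf ?_
    filter_upwards [hbounds] with α h
    exact EReal.coe_le_coe_iff.2 h.2

/-- Case `c = 0` is the centre of the ball, for which every `z` on the sphere is allowed. -/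
theorem sphericalIndex_ball_eq_one (hm : 1 ≤ m) (hR : 0 < R) (hz : z ∈ Metric.sphere x₀ R)
    (hc : c < 1) (hx₁ : x₁ - x₀ = c • (z - x₀)) :
    sphericalIndex (Metric.ball x₀ R) x₁ z = 1 := by
  have hK := halfSphereArea_pos m
  have hev : ∀ᶠ ρ : ℝ in 𝓝[>] 0, 0 < ρ ∧ 2 * ρ < R := by
    filter_upwards [Ioo_mem_nhdsGT (by positivity : 0 < R / 2)] with ρ hρ
    exact ⟨hρ.1, by linarith [hρ.2]⟩
  have hlim := tendsto_of_tendsto_of_tendsto_of_le_of_le'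
    ((continuous_coe_real_ereal.tendsto _).comp
      ((tendsto_chartConst_zpow m hR).const_mul ((1 - c) * R)))
    ((continuous_coe_real_ereal.tendsto _).comp
      ((tendsto_axialBound m hR).const_mul ((1 - c) * R)))
    (hev.mono fun ρ hρ => (liminf_flatnessIntegral_bounds hm hR hz hc hx₁ hρ.1 hρ.2).1)
    (hev.mono fun ρ hρ => (liminf_flatnessIntegral_bounds hm hR hz hc hx₁ hρ.1 hρ.2).2)
  have hr : ‖z - x₁‖ = (1 - c) * R := by
    have : z - x₁ = (1 - c) • (z - x₀) := by rw [sub_smul, one_smul, ← hx₁]; abel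
    rw [this, norm_smul, mem_sphere_iff_norm.1 hz, Real.norm_of_nonneg (by linarith)]
  rw [sphericalIndex, hlim.liminf_eq, ← EReal.coe_mul, hr, natCast_mul_unitBallVolume]
  have h1c : 0 < 1 - c := by linarith
  rw [← EReal.coe_one, EReal.coe_eq_coe_iff]
  field_simp

end Limit

/-! ### The touching set of a ball -/

section Touching

variable {V : Type*} [NormedAddCommGroup V] [InnerProductSpace ℝ V] {x₀ x₁ z : V} {R c : ℝ}

theorem infDist_sphere_of_smul (hz : z ∈ Metric.sphere x₀ R) (hc0 : 0 ≤ c)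
    (hc : c < 1) (hx₁ : x₁ - x₀ = c • (z - x₀)) :
    Metric.infDist x₁ (Metric.sphere x₀ R) = (1 - c) * R ∧ dist x₁ z = (1 - c) * R := by
  have hzn := mem_sphere_iff_norm.1 hz
  have h1 : dist x₁ z = (1 - c) * R := by
    have : z - x₁ = (1 - c) • (z - x₀) := by rw [sub_smul, one_smul, ← hx₁]; abel
    rw [dist_comm, dist_eq_norm, this, norm_smul, hzn, Real.norm_of_nonneg (by linarith)]
  refine ⟨le_antisymm (h1 ▸ Metric.infDist_le_dist_of_mem hz) ?_, h1⟩
  refine (Metric.le_infDist ⟨z, hz⟩).2 fun x hx => ?_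
  have h2 : dist x₁ x₀ = c * R := by
    rw [dist_eq_norm, hx₁, norm_smul, hzn, Real.norm_of_nonneg hc0]
  have h3 := dist_triangle_left x x₀ x₁
  rw [Metric.mem_sphere.1 hx] at h3
  linarith

/-- For an off-centre point, equality in the triangle inequality picks out a single point. -/
theorem eq_of_dist_eq_of_smul (hz : z ∈ Metric.sphere x₀ R) (hc0 : 0 < c)
    (hx₁ : x₁ - x₀ = c • (z - x₀)) {x : V} (hx : x ∈ Metric.sphere x₀ R)
    (hdx : dist x₁ x = (1 - c) * R) : x = z := by
  have hzn := mem_sphere_iff_norm.1 hz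
  have hxn := mem_sphere_iff_norm.1 hx
  have h1 : ‖(x - x₀) - c • (z - x₀)‖ ^ 2 = ((1 - c) * R) ^ 2 := by
    rw [← hx₁, ← hdx, dist_comm, dist_eq_norm]
    congr 2; abel
  rw [norm_sub_sq_real, inner_smul_right, norm_smul, hzn, hxn, mul_pow, Real.norm_eq_abs,
    sq_abs] at h1
  have h2 : inner ℝ (x - x₀) (z - x₀) = R ^ 2 := by
    refine mul_left_cancel₀ hc0.ne' ?_
    linarith
  have h3 : ‖(x - x₀) - (z - x₀)‖ ^ 2 = 0 := by
    rw [norm_sub_sq_real, hzn, hxn, h2]; ring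
  rw [sq_eq_zero_iff, norm_eq_zero, sub_sub_sub_cancel_right, sub_eq_zero] at h3
  exact h3

end Touching

theorem touchingSet_eq_inter_sphere {n : ℕ} (Ω : Set (EuclideanSpace ℝ (Fin n)))
    (x : EuclideanSpace ℝ (Fin n)) :
    touchingSet Ω x = frontier Ω ∩ Metric.sphere x (Metric.infDist x (frontier Ω)) := by
  ext z
  rw [touchingSet, Set.mem_ofPred_eq, Set.mem_inter_iff, Metric.mem_sphere, dist_comm]

/-! ### Balls have spherical index one -/

theorem proposition2p2 (n : ℕ) (hn : 2 ≤ n) (x₀ x₁ : EuclideanSpace ℝ (Fin n)) (R : ℝ)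
    (hR : 0 < R) (hx₁ : x₁ ∈ Metric.ball x₀ R) :
    (x₁ ≠ x₀ → ∃ z : EuclideanSpace ℝ (Fin n),
      touchingSet (Metric.ball x₀ R) x₁ = {z} ∧
      frontier (Metric.ball x₀ R) ∩
        Metric.sphere x₁ (Metric.infDist x₁ (frontier (Metric.ball x₀ R))) = {z} ∧
      sphericalIndex (Metric.ball x₀ R) x₁ z = 1) ∧
    (x₁ = x₀ →
      touchingSet (Metric.ball x₀ R) x₁ = frontier (Metric.ball x₀ R) ∧
      ∀ z ∈ frontier (Metric.ball x₀ R), sphericalIndex (Metric.ball x₀ R) x₁ z = 1) := by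
  obtain ⟨m, rfl⟩ : ∃ m, n = m + 1 := ⟨n - 1, by omega⟩
  have hm : 1 ≤ m := by omega
  refine ⟨fun hne => ?_, ?_⟩
  · rw [mem_ball_iff_norm] at hx₁
    set s := ‖x₁ - x₀‖
    have hs : 0 < s := norm_pos_iff.2 (sub_ne_zero.2 hne)
    -- `z` is the endpoint of the radius through `x₁`
    let z := x₀ + (R / s) • (x₁ - x₀)
    have hz : z ∈ Metric.sphere x₀ R := by
      rw [mem_sphere_iff_norm, add_sub_cancel_left, norm_smul, Real.norm_of_nonneg (by positivity)]
      exact div_mul_cancel₀ R hs.ne'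
    have hc0 : 0 < s / R := by positivity
    have hc : s / R < 1 := (div_lt_one hR).2 hx₁
    have hxz : x₁ - x₀ = (s / R) • (z - x₀) := by
      rw [add_sub_cancel_left, smul_smul, div_mul_div_cancel₀ hR.ne', div_self hs.ne', one_smul]
    obtain ⟨hinf, hdist⟩ := infDist_sphere_of_smul hz hc0.le hc hxz
    have htouch : touchingSet (Metric.ball x₀ R) x₁ = {z} := by
      ext x
      rw [touchingSet, Set.mem_ofPred_eq, frontier_ball _ hR.ne', hinf, Set.mem_singleton_iff]
      refine ⟨fun h => eq_of_dist_eq_of_smul hz hc0 hxz h.1 h.2, ?_⟩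
      rintro rfl
      exact ⟨hz, hdist⟩
    exact ⟨z, htouch, touchingSet_eq_inter_sphere _ x₁ ▸ htouch,
      sphericalIndex_ball_eq_one hm hR hz hc hxz⟩
  · rintro rfl
    rw [frontier_ball _ hR.ne']
    refine ⟨?_, fun z hz => sphericalIndex_ball_eq_one hm hR hz zero_lt_one (by simp)⟩
    ext z
    rw [touchingSet, Set.mem_ofPred_eq, frontier_ball _ hR.ne']
    refine ⟨fun h => h.1, fun hz => ⟨hz, ?_⟩⟩
    obtain ⟨hinf, hdist⟩ := infDist_sphere_of_smul hz le_rfl zero_lt_one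
      (x₁ := x₁) (by simp)
    rw [hinf, hdist]
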